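/- Let $C_2=\langle\sigma\rangle$ be the group of order $2$ and let $B_k$ be the $k$-fold iterated wreath power of $C_2$: $B_1=C_2$ and $B_k=B_{k-1}\wr C_2$ for $k>1$. Elements of $B_k$ ($k>1$) are written $(g_1,g_2)\pi$ with $g_1,g_2\in B_{k-1}$, $\pi\in C_2$, and are multiplied by $(g_1,g_2)\pi\cdot(h_1,h_2)\rho=(g_1h_{\pi(1)},g_2h_{\pi(2)})\pi\rho$, where $\sigma$ exchanges the indices $1$ and $2$. Define $G_1=\{e\}\le B_1$ and $G_k=\{(g_1,g_2)\pi\in B_k : g_1g_2\in G_{k-1}\}$ for $k>1$; these are subgroups of $B_k$. For elements of a group put $[a,b]=aba^{-1}b^{-1}$. The commutator length of an element $g$ of the derived subgroup $G'$ of a group $G$ is the least $n\ge 0$ such that $g=[x_1,y_1]\cdots[x_n,y_n]$ with $x_i,y_i\in G$ (so the identity has length $0$), and the commutator width $cw(G)$ is the maximum of the commutator lengths of the elements of $G'$. Theorem. Let $k\ge 1$. 1. Every Sylow $2$-subgroup $Syl_2A_{2^k}$ of the alternating group $A_{2^k}$ is isomorphic to $G_k$. 2. The derived subgroup of $G_k$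 is exactly the set of commutators: $G_k'=\{[f_1,f_2] : f_1,f_2\in G_k\}$. 3. $cw(Syl_2A_{2^k})\le 1$ for all $k\ge 2$. More precisely, $cw(Syl_2A_{2^k})=1$ for all $k\ge 3$, while $cw(Syl_2A_4)=0$, since $Syl_2A_4$ is abelian. -/

import Mathlib

/-- The cyclic group `C₂` of order two, written multiplicatively. -/
abbrev C2 : Type := Multiplicative (ZMod 2)

/-- The nontrivial element `σ` of `C₂`. -/
def C2.swap : C2 := Multiplicative.ofAdd 1

/-- The `k`-fold iterated wreath power `B_k` of `C₂`, so that `B_{k+1} = B_k ≀ C₂`.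
An element of `B_{k+1}` is `(g₁, g₂)π` with `g₁ = left 1`, `g₂ = left σ`, `π = right`. -/
abbrev WreathPower (k : ℕ) : Type := IteratedWreathProduct C2 k

/-- The first coordinate `g₁` of `(g₁, g₂)π ∈ B_{k+1}`. -/
def WreathPower.fst {k : ℕ} (g : WreathPower (k + 1)) : WreathPower k :=
  RegularWreathProduct.left (D := WreathPower k) (Q := C2) g 1

/-- The second coordinate `g₂` of `(g₁, g₂)π ∈ B_{k+1}`. -/
def WreathPower.snd {k : ℕ} (g : WreathPower (k + 1)) : WreathPower k :=
  RegularWreathProduct.left (D := WreathPower k) (Q := C2) g C2.swap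

/-- The underlying set of `G_k`: `G_1` is trivial and
`G_k = {(g₁, g₂)π ∈ B_k ∣ g₁ g₂ ∈ G_{k-1}}` for `k > 1`.
(`B_0` is the trivial group, and `G_0` is all of it; the value at `0` is not used.) -/
def sylCarrier : (k : ℕ) → Set (WreathPower k)
  | 0 => Set.univ
  | 1 => {1}
  | k + 2 => {g | g.fst * g.snd ∈ sylCarrier (k + 1)}

theorem C2.cases (c : C2) : c = 1 ∨ c = C2.swap := by
  revert c; decide

theorem WreathPower.fst_snd_mul {k : ℕ} (a b : WreathPower (k + 1)) :
    ((a * b).fst = a.fst * b.fst ∧ (a * b).snd = a.snd * b.snd) ∨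
    ((a * b).fst = a.fst * b.snd ∧ (a * b).snd = a.snd * b.fst) := by
  rcases C2.cases (RegularWreathProduct.right (D := WreathPower k) (Q := C2) a) with h | h
  · left
    constructor
    · change _ * RegularWreathProduct.left (D := WreathPower k) (Q := C2) b (_ * _) = _
      rw [h]; rfl
    · change _ * RegularWreathProduct.left (D := WreathPower k) (Q := C2) b (_ * _) = _
      rw [h]; rfl
  · right
    constructor
    · change _ * RegularWreathProduct.left (D := WreathPower k) (Q := C2) b (_ * _) = _
      rw [h]; rfl
    · change _ * RegularWreathProduct.left (D := WreathPower k) (Q := C2) b (_ * _) = _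
      rw [h]; rfl

theorem WreathPower.one_or_eq (a b : WreathPower 1) : (a * b = 1) ↔ (a = 1 ↔ b = 1) := by
  have key : ∀ c : WreathPower 1,
      c = 1 ↔ RegularWreathProduct.right (D := WreathPower 0) (Q := C2) c = 1 := by
    intro c
    refine ⟨fun h => by rw [h]; rfl, fun h => ?_⟩
    refine RegularWreathProduct.ext (D := WreathPower 0) (Q := C2) ?_ h
    funext x
    exact Subsingleton.elim (α := PUnit) _ _
  rw [key, key a, key b]
  change RegularWreathProduct.right (D := WreathPower 0) (Q := C2) a *
    RegularWreathProduct.right (D := WreathPower 0) (Q := C2) b = 1 ↔ _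
  generalize RegularWreathProduct.right (D := WreathPower 0) (Q := C2) a = x
  generalize RegularWreathProduct.right (D := WreathPower 0) (Q := C2) b = y
  revert x y; decide

theorem mul_mem_sylCarrier_iff : ∀ (k : ℕ) (a b : WreathPower k),
    a * b ∈ sylCarrier k ↔ (a ∈ sylCarrier k ↔ b ∈ sylCarrier k)
  | 0, _, _ => iff_of_true trivial (iff_of_true trivial trivial)
  | 1, a, b => WreathPower.one_or_eq a b
  | k + 2, a, b => by
    have ih := mul_mem_sylCarrier_iff (k + 1)
    change (a * b).fst * (a * b).snd ∈ sylCarrier (k + 1) ↔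
      (a.fst * a.snd ∈ sylCarrier (k + 1) ↔ b.fst * b.snd ∈ sylCarrier (k + 1))
    rcases WreathPower.fst_snd_mul a b with ⟨h1, h2⟩ | ⟨h1, h2⟩ <;>
    · rw [h1, h2]
      simp only [ih]
      tauto

/-- The recursively constructed group `G_k`, as a subgroup of `B_k`. -/
def sylG (k : ℕ) : Subgroup (WreathPower k) where
  carrier := sylCarrier k
  mul_mem' {a b} ha hb := (mul_mem_sylCarrier_iff k a b).2 (iff_of_true ha hb)
  one_mem' := by
    have h := mul_mem_sylCarrier_iff k 1 1
    rw [mul_one] at h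
    exact h.2 Iff.rfl
  inv_mem' {a} ha := by
    have h1 := mul_mem_sylCarrier_iff k 1 1
    rw [mul_one] at h1
    have h := mul_mem_sylCarrier_iff k a a⁻¹
    rw [mul_inv_cancel] at h
    exact (h.1 (h1.2 Iff.rfl)).1 ha

/-- The commutator length of `g`: the least `n` such that `g = [x₁, y₁] ⋯ [xₙ, yₙ]`
for some `xᵢ, yᵢ` (and `⊤` if `g` is not a product of commutators). -/
noncomputable def commutatorLength {G : Type*} [Group G] (g : G) : ℕ∞ :=
  ⨅ (n : ℕ) (_ : ∃ x y : Fin n → G, g = (List.ofFn fun i => x i * y i * (x i)⁻¹ * (y i)⁻¹).prod), (n : ℕ∞)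

/-- The commutator width of `G`: the maximum of the commutator lengths of the elements of
its derived subgroup (`⊤` if these are unbounded). -/
noncomputable def commutatorWidth (G : Type*) [Group G] : ℕ∞ :=
  ⨆ g ∈ commutator G, commutatorLength g

/-! Everything rests on one equation: `[(h, 1)σ, (c₂b, b)] = (c₁, c₂)` whenever `[h, b] = c₁c₂`. An
element of `B_{k+1}'` is a pair `(c₁, c₂)` with `c₁c₂ ∈ B_k'`, so by induction every element of
`B_k'` is some `[h, b]`, and the left entry `h` can be kept in `G_k` (`exists_commutator_eq`). An
element of `G_{k+2}'` moreover has `c₂ ∈ G_{k+1}`. As membership in `G_{k+1}` is a parity, this puts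
both entries of the commutator in `G_{k+2}` (`mk_one_eq_commutator`). For the Sylow claim, `B_k`
acts faithfully on `2^k` points and `G_k` is its even part; comparing orders finishes. -/

namespace WreathPower

/-! ### Coordinates and the basic commutator equation. -/

variable {k : ℕ}

/-- The projection `(g₁, g₂)π ↦ π`. -/
def rightHom (k : ℕ) : WreathPower (k + 1) →* C2 :=
  RegularWreathProduct.rightHom (D := WreathPower k) (Q := C2)

/-- The element `(a, b)p` of `B_{k+1}`. -/
def mk (a b : WreathPower k) (p : C2) : WreathPower (k + 1) :=
  RegularWreathProduct.mk (D := WreathPower k) (Q := C2) (fun q => if q = 1 then a else b) p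

@[simp] theorem fst_mk (a b : WreathPower k) (p : C2) : (mk a b p).fst = a := rfl

@[simp] theorem snd_mk (a b : WreathPower k) (p : C2) : (mk a b p).snd = b := rfl

@[simp] theorem rightHom_mk (a b : WreathPower k) (p : C2) : rightHom k (mk a b p) = p := rfl

theorem eq_of_coordinates {g h : WreathPower (k + 1)} (h₁ : g.fst = h.fst) (h₂ : g.snd = h.snd)
    (h₃ : rightHom k g = rightHom k h) : g = h := by
  refine RegularWreathProduct.ext (D := WreathPower k) (Q := C2) ?_ h₃
  funext q
  rcases C2.cases q with rfl | rfl
  exacts [h₁, h₂]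

theorem mk_coordinates (g : WreathPower (k + 1)) : mk g.fst g.snd (rightHom k g) = g :=
  eq_of_coordinates rfl rfl rfl

theorem mul_of_rightHom_eq_one {a : WreathPower (k + 1)} (b : WreathPower (k + 1))
    (h : rightHom k a = 1) :
    (a * b).fst = a.fst * b.fst ∧ (a * b).snd = a.snd * b.snd := by
  change RegularWreathProduct.right (D := WreathPower k) (Q := C2) a = 1 at h
  constructor <;>
  · change _ * RegularWreathProduct.left (D := WreathPower k) (Q := C2) b (_ * _) = _
    rw [h]
    rfl

theorem mul_of_rightHom_eq_swap {a : WreathPower (k + 1)} (b : WreathPower (k + 1))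
    (h : rightHom k a = C2.swap) :
    (a * b).fst = a.fst * b.snd ∧ (a * b).snd = a.snd * b.fst := by
  change RegularWreathProduct.right (D := WreathPower k) (Q := C2) a = C2.swap at h
  constructor <;>
  · change _ * RegularWreathProduct.left (D := WreathPower k) (Q := C2) b (_ * _) = _
    rw [h]
    rfl

theorem mk_one_mul_mk (a₁ a₂ b₁ b₂ : WreathPower k) (p : C2) :
    mk a₁ a₂ 1 * mk b₁ b₂ p = mk (a₁ * b₁) (a₂ * b₂) p :=
  
  eq_of_coordinates (mul_of_rightHom_eq_one _ rfl).1 (mul_of_rightHom_eq_one _ rfl).2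
    (by rw [map_mul]; exact one_mul p)

theorem mk_swap_mul_mk (a₁ a₂ b₁ b₂ : WreathPower k) (p : C2) :
    mk a₁ a₂ C2.swap * mk b₁ b₂ p = mk (a₁ * b₂) (a₂ * b₁) (C2.swap * p) :=
  
  eq_of_coordinates (mul_of_rightHom_eq_swap _ rfl).1 (mul_of_rightHom_eq_swap _ rfl).2
    (by rw [map_mul]; rfl)

/-- The homomorphism `(g₁, g₂)π ↦ g₁ g₂` modulo the derived subgroup. -/
def prodHom (k : ℕ) : WreathPower (k + 1) →* Abelianization (WreathPower k) where
  toFun g := Abelianization.of (g.fst * g.snd)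
  map_one' := by
    change Abelianization.of ((1 : WreathPower k) * 1) = 1
    simp
  map_mul' a b := by
    rcases fst_snd_mul a b with ⟨h₁, h₂⟩ | ⟨h₁, h₂⟩ <;> simp only [h₁, h₂, map_mul]
    · exact mul_mul_mul_comm _ _ _ _
    · rw [mul_mul_mul_comm, mul_comm (Abelianization.of b.snd)]

theorem fst_mul_snd_mem_commutator {g : WreathPower (k + 1)} (hg : prodHom k g = 1) :
    g.fst * g.snd ∈ commutator (WreathPower k) := by
  rw [← Abelianization.ker_of]
  exact hg

/-- The equation `[(h, 1)σ, (c₂ b, b)] = (c₁, c₂)` holds as soon as `[h, b] = c₁ c₂`. -/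
theorem mk_commutator {c₁ c₂ h b : WreathPower k} (H : h * b = c₁ * c₂ * (b * h)) :
    mk h 1 C2.swap * mk (c₂ * b) b 1 =
      mk c₁ c₂ 1 * (mk (c₂ * b) b 1 * mk h 1 C2.swap) := by
  simp only [mk_swap_mul_mk, mk_one_mul_mk, mul_one, one_mul, H, mul_assoc]

theorem mem_sylG_succ_succ {g : WreathPower (k + 2)} :
    g ∈ sylG (k + 2) ↔ (g.fst ∈ sylG (k + 1) ↔ g.snd ∈ sylG (k + 1)) :=
  mul_mem_sylCarrier_iff (k + 1) g.fst g.snd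

theorem mul_mem_sylG_iff (a b : WreathPower k) : a * b ∈ sylG k ↔ (a ∈ sylG k ↔ b ∈ sylG k) :=
  mul_mem_sylCarrier_iff k a b

theorem mk_mem_sylG_of_mem {h : WreathPower k} (hh : h ∈ sylG k) (hk : k ≠ 0) :
    mk h 1 C2.swap ∈ sylG (k + 1) := by
  obtain ⟨k, rfl⟩ := Nat.exists_eq_succ_of_ne_zero hk
  rw [mem_sylG_succ_succ]
  exact iff_of_true hh (one_mem _)

/-- Every element of the derived subgroup of `B_k` is a commutator `[h, b]` with `h ∈ G_k`. -/
theorem exists_commutator_eq (k : ℕ) (g : WreathPower k) (hg : g ∈ commutator (WreathPower k)) :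
    ∃ h ∈ sylG k, ∃ b, h * b = g * (b * h) := by
  induction k with
  | zero => exact ⟨1, one_mem _, 1, Subsingleton.elim (α := PUnit) _ _⟩
  | succ k ih =>
    have h₁ : prodHom k g = 1 := Abelianization.commutator_subset_ker _ hg
    have h₂ : rightHom k g = 1 := Abelianization.commutator_subset_ker _ hg
    -- `B_1` is separate because `(1, 1)σ ∉ G_1`; there `g` is trivial.
    rcases Nat.eq_zero_or_pos k with rfl | hk
    · refine ⟨1, one_mem _, 1, ?_⟩
      have : g = 1 := eq_of_coordinates (Subsingleton.elim (α := PUnit) _ _)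
        (Subsingleton.elim (α := PUnit) _ _) (by rw [h₂, map_one])
      rw [this]
      exact (one_mul _).symm
    · obtain ⟨h, hh, b, H⟩ := ih _ (fst_mul_snd_mem_commutator h₁)
      refine ⟨_, mk_mem_sylG_of_mem hh hk.ne', mk (g.snd * b) b 1, ?_⟩
      rw [mk_commutator H]
      congr 1
      rw [← h₂, mk_coordinates]

/-- A pair `(c₁, c₂)` with `c₂ ∈ G_{k+1}` and `c₁ c₂ ∈ B_{k+1}'` is a commutator in `G_{k+2}`. -/
theorem mk_one_eq_commutator {c₁ c₂ : WreathPower (k + 1)} (hc₂ : c₂ ∈ sylG (k + 1))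
    (hc : c₁ * c₂ ∈ commutator (WreathPower (k + 1))) :
    ∃ x y : sylG (k + 2), mk c₁ c₂ 1 = ((x * y * x⁻¹ * y⁻¹ : sylG (k + 2)) : WreathPower (k + 2)) := by
  obtain ⟨h, hh, b, H⟩ := exists_commutator_eq _ _ hc
  -- The parity of `b` occurs twice and cancels, leaving that of `c₂`.
  have hy : mk (c₂ * b) b 1 ∈ sylG (k + 2) := by
    rw [mem_sylG_succ_succ, fst_mk, snd_mk, mul_mem_sylG_iff]
    tauto
  refine ⟨⟨_, mk_mem_sylG_of_mem hh k.succ_ne_zero⟩, ⟨_, hy⟩, ?_⟩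
  simp only [Subgroup.coe_mul, Subgroup.coe_inv]
  rw [eq_mul_inv_iff_mul_eq, eq_mul_inv_iff_mul_eq, mk_commutator H, mul_assoc]

/-- The derived subgroup of `G_k` only contains elements with second coordinate in `G_{k-1}`. -/
theorem snd_mem_of_mem_commutator {g : sylG (k + 2)} (hg : g ∈ commutator (sylG (k + 2))) :
    (g : WreathPower (k + 2)).snd ∈ sylG (k + 1) := by
  -- Both coordinates of an element of `G_{k+2}` have the same parity, so swapping them is harmless
  -- and the parity of `snd` is a homomorphism to a group of order two. Hence it kills commutators.
  have key (a b : sylG (k + 2)) : ((a * b : sylG (k + 2)) : WreathPower (k + 2)).snd ∈ sylG (k + 1) ↔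
      ((a : WreathPower (k + 2)).snd ∈ sylG (k + 1) ↔ (b : WreathPower (k + 2)).snd ∈ sylG (k + 1)) := by
    have hb := mem_sylG_succ_succ.1 b.2
    rw [Subgroup.coe_mul]
    rcases fst_snd_mul (a : WreathPower (k + 2)) b with ⟨-, h⟩ | ⟨-, h⟩ <;>
      rw [h, mul_mem_sylG_iff]
    rw [hb]
  have h1 : ((1 : sylG (k + 2)) : WreathPower (k + 2)).snd ∈ sylG (k + 1) := one_mem (sylG (k + 1))
  have hinv (a : sylG (k + 2)) : ((a⁻¹ : sylG (k + 2)) : WreathPower (k + 2)).snd ∈ sylG (k + 1) ↔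
      (a : WreathPower (k + 2)).snd ∈ sylG (k + 1) := by
    have := key a a⁻¹
    rw [mul_inv_cancel] at this
    tauto
  let S : Subgroup (sylG (k + 2)) :=
    { carrier := {g | (g : WreathPower (k + 2)).snd ∈ sylG (k + 1)}
      mul_mem' := fun ha hb => (key _ _).2 (iff_of_true ha hb)
      one_mem' := h1
      inv_mem' := fun {a} ha => (hinv a).2 ha }
  refine (show commutator (sylG (k + 2)) ≤ S from ?_) hg
  rw [commutator_def, Subgroup.commutator_le]
  intro a _ b _
  change ((a * b * a⁻¹ * b⁻¹ : sylG (k + 2)) : WreathPower (k + 2)).snd ∈ sylG (k + 1)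
  rw [key, key, key, hinv, hinv]
  tauto

end WreathPower

/-! ### The derived subgroup of `G_k`. -/

open WreathPower

theorem subsingleton_sylG_one : Subsingleton (sylG 1) :=
  ⟨fun a b => Subtype.ext ((show (a : WreathPower 1) = 1 from a.2).trans
    (show (b : WreathPower 1) = 1 from b.2).symm)⟩

theorem exists_commutator_of_mem_commutator_sylG {k : ℕ} (hk : 1 ≤ k) {g : sylG k}
    (hg : g ∈ commutator (sylG k)) : ∃ x y : sylG k, g = x * y * x⁻¹ * y⁻¹ := by
  obtain _ | _ | k := k
  · omega
  · exact ⟨1, 1, subsingleton_sylG_one.elim _ _⟩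
  · have h₁ : prodHom (k + 1) g = 1 :=
      Abelianization.commutator_subset_ker ((prodHom (k + 1)).comp (sylG (k + 2)).subtype) hg
    have h₂ : rightHom (k + 1) g = 1 :=
      Abelianization.commutator_subset_ker ((rightHom (k + 1)).comp (sylG (k + 2)).subtype) hg
    obtain ⟨x, y, h⟩ :=
      mk_one_eq_commutator (snd_mem_of_mem_commutator hg) (fst_mul_snd_mem_commutator h₁)
    rw [← h₂, mk_coordinates] at h
    exact ⟨x, y, Subtype.ext h⟩

theorem coe_commutator_sylG {k : ℕ} (hk : 1 ≤ k) :
    (commutator (sylG k) : Set (sylG k)) = {w | ∃ f₁ f₂ : sylG k, w = f₁ * f₂ * f₁⁻¹ * f₂⁻¹} := by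
  ext w
  refine ⟨exists_commutator_of_mem_commutator_sylG hk, ?_⟩
  rintro ⟨x, y, rfl⟩
  exact Subgroup.commutator_mem_commutator (Subgroup.mem_top x) (Subgroup.mem_top y)

theorem exists_ne_one_mem_commutator_sylG {k : ℕ} (hk : 3 ≤ k) :
    ∃ g ∈ commutator (sylG k), g ≠ 1 := by
  obtain ⟨k, rfl⟩ := Nat.exists_eq_add_of_le' hk
  have hs : mk 1 1 C2.swap ∈ sylG (k + 2) := mk_mem_sylG_of_mem (one_mem _) k.succ_ne_zero
  obtain ⟨t, ht, hts⟩ : ∃ t : WreathPower (k + 2), rightHom (k + 1) t ≠ 1 ∧ t ∈ sylG (k + 2) :=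
    ⟨mk 1 1 C2.swap, show C2.swap ≠ 1 by decide, hs⟩
  -- The witness is `(t⁻¹, t)`, with coordinate product `1`. It needs a nontrivial `t` in the
  -- previous group, which is available only from `G_2` on.
  obtain ⟨x, y, h⟩ := mk_one_eq_commutator (c₁ := t⁻¹) hts (by rw [inv_mul_cancel]; exact one_mem _)
  refine ⟨_, Subgroup.commutator_mem_commutator (Subgroup.mem_top x) (Subgroup.mem_top y),
    fun h1 => ht ?_⟩
  have h2 : mk t⁻¹ t 1 = 1 := h.trans (congrArg Subtype.val h1)
  have h3 : (mk t⁻¹ t 1).snd = (1 : WreathPower (k + 3)).snd := by rw [h2]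
  rw [snd_mk] at h3
  rw [h3]
  exact map_one (rightHom (k + 1))

theorem commutator_sylG_two : commutator (sylG 2) = ⊥ := by
  rw [eq_bot_iff]
  intro g hg
  have h₂ : rightHom 1 g = 1 :=
    Abelianization.commutator_subset_ker ((rightHom 1).comp (sylG 2).subtype) hg
  have hs : (g : WreathPower 2).snd = 1 := snd_mem_of_mem_commutator hg
  have hf : (g : WreathPower 2).fst = 1 := (mem_sylG_succ_succ.1 g.2).2 hs
  rw [Subgroup.mem_bot]
  exact Subtype.ext (eq_of_coordinates hf hs h₂)

/-! ### Commutator length and width. -/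

theorem commutatorLength_one {G : Type*} [Group G] : commutatorLength (1 : G) = 0 :=
  nonpos_iff_eq_zero.1 (iInf₂_le_of_le 0 ⟨1, 1, by simp⟩ (by simp))

theorem commutatorLength_commutator_le {G : Type*} [Group G] (x y : G) :
    commutatorLength (x * y * x⁻¹ * y⁻¹) ≤ 1 :=
  iInf₂_le_of_le 1 ⟨fun _ => x, fun _ => y, by simp⟩ (by simp)

theorem one_le_commutatorLength {G : Type*} [Group G] {g : G} (hg : g ≠ 1) :
    1 ≤ commutatorLength g := by
  refine le_iInf₂ fun n hn => ?_
  obtain _ | n := n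
  · obtain ⟨x, y, h⟩ := hn
    exact absurd (by simpa using h) hg
  · exact_mod_cast Nat.le_add_left 1 n

theorem commutatorWidth_le_one {G : Type*} [Group G]
    (h : ∀ g ∈ commutator G, ∃ x y : G, g = x * y * x⁻¹ * y⁻¹) : commutatorWidth G ≤ 1 := by
  refine iSup₂_le fun g hg => ?_
  obtain ⟨x, y, rfl⟩ := h g hg
  exact commutatorLength_commutator_le x y

theorem commutatorWidth_eq_zero {G : Type*} [Group G] (h : commutator G = ⊥) :
    commutatorWidth G = 0 := by
  refine nonpos_iff_eq_zero.1 (iSup₂_le fun g hg => ?_)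
  rw [h, Subgroup.mem_bot] at hg
  rw [hg, commutatorLength_one]

theorem one_le_commutatorWidth {G : Type*} [Group G] (h : ∃ g ∈ commutator G, g ≠ 1) :
    1 ≤ commutatorWidth G := by
  obtain ⟨g, hg, hne⟩ := h
  exact (one_le_commutatorLength hne).trans
    (le_iSup₂ (f := fun g (_ : g ∈ commutator G) => commutatorLength g) g hg)

theorem commutatorLength_map {G H : Type*} [Group G] [Group H] (f : G →* H) (g : G) :
    commutatorLength (f g) ≤ commutatorLength g := by
  refine le_iInf₂ fun n hn => ?_
  obtain ⟨x, y, rfl⟩ := hn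
  refine iInf₂_le n ⟨f ∘ x, f ∘ y, ?_⟩
  rw [map_list_prod, List.map_ofFn]
  congr 2
  funext i
  simp

theorem commutatorWidth_le_of_surjective {G H : Type*} [Group G] [Group H] (f : G →* H)
    (hf : Function.Surjective f) : commutatorWidth H ≤ commutatorWidth G := by
  refine iSup₂_le fun h hh => ?_
  have : commutator H = (commutator G).map f := by
    rw [commutator_def, commutator_def, Subgroup.map_commutator, Subgroup.map_top_of_surjective f hf]
  rw [this] at hh
  obtain ⟨g, hg, rfl⟩ := hh
  exact (commutatorLength_map f g).trans
    (le_iSup₂ (f := fun g (_ : g ∈ commutator G) => commutatorLength g) g hg)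

theorem MulEquiv.commutatorWidth_eq {G H : Type*} [Group G] [Group H] (e : G ≃* H) :
    commutatorWidth G = commutatorWidth H :=
  (commutatorWidth_le_of_surjective e.symm.toMonoidHom e.symm.surjective).antisymm
    (commutatorWidth_le_of_surjective e.toMonoidHom e.surjective)

/-! ### Signs in the wreath product action. -/

theorem RegularWreathProduct.sign_toPerm {D Q Λ : Type*} [Group D] [Group Q] [MulAction D Λ]
    [Fintype Q] [DecidableEq Q] [Fintype Λ] [DecidableEq Λ] (w : D ≀ᵣ Q) :
    Equiv.Perm.sign (toPerm D Q Λ w) =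
      (∏ q, Equiv.Perm.sign (MulAction.toPerm (w.left q) : Equiv.Perm Λ)) *
        Equiv.Perm.sign (Equiv.mulLeft w.right) ^ Fintype.card Λ := by
  -- `w` permutes the `Q`-coordinate, identically over each point of `Λ`, and then acts on each
  -- fibre `Λ` separately.
  have h : toPerm D Q Λ w =
      Equiv.prodCongrLeft (fun q => (MulAction.toPerm (w.left q) : Equiv.Perm Λ)) *
        Equiv.prodCongrRight (fun _ : Λ => Equiv.mulLeft w.right) := by
    ext p <;> rfl
  rw [h, Equiv.Perm.sign_mul, Equiv.Perm.sign_prodCongrLeft, Equiv.Perm.sign_prodCongrRight,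
    Finset.prod_const, Finset.card_univ]

theorem C2.univ_eq : (Finset.univ : Finset C2) = {1, C2.swap} := by decide

theorem sign_iteratedWreathToPermHom_succ {k : ℕ} (g : WreathPower (k + 1)) :
    Equiv.Perm.sign (iteratedWreathToPermHom C2 (k + 1) g) =
      Equiv.Perm.sign (iteratedWreathToPermHom C2 k g.fst) *
        Equiv.Perm.sign (iteratedWreathToPermHom C2 k g.snd) *
        Equiv.Perm.sign (Equiv.mulLeft (rightHom k g)) ^ 2 ^ k := by
  let _ := MulAction.compHom (Fin k → C2) (iteratedWreathToPermHom C2 k)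
  have h := RegularWreathProduct.sign_toPerm (D := WreathPower k) (Q := C2) (Λ := Fin k → C2) g
  rw [C2.univ_eq, Finset.prod_pair (by decide)] at h
  have hc : Fintype.card (Fin k → C2) = 2 ^ k := by simp
  have ht (d : WreathPower k) : (MulAction.toPerm d : Equiv.Perm (Fin k → C2)) =
      iteratedWreathToPermHom C2 k d := Equiv.ext fun _ => rfl
  rw [hc] at h
  erw [ht, ht] at h
  refine Eq.trans ?_ h
  exact Equiv.Perm.sign_permCongr _ _

/-- The top swap contributes its sign to the power `2 ^ k`, which is odd only at level one. Above
that, the sign is the product of the coordinate signs, matching the recursion for `G_k`. -/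
theorem sign_iteratedWreathToPermHom_eq_one_iff (k : ℕ) (g : WreathPower (k + 1)) :
    Equiv.Perm.sign (iteratedWreathToPermHom C2 (k + 1) g) = 1 ↔ g ∈ sylG (k + 1) := by
  induction k with
  | zero =>
    rw [sign_iteratedWreathToPermHom_succ]
    change 1 * 1 * _ = _ ↔ g = 1
    rw [one_mul, one_mul, pow_zero, pow_one]
    constructor
    · intro h
      refine eq_of_coordinates (Subsingleton.elim (α := PUnit) _ _)
        (Subsingleton.elim (α := PUnit) _ _) ?_
      rw [map_one]
      generalize rightHom 0 g = c at h
      revert c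
      decide
    · rintro rfl
      rw [map_one]
      decide
  | succ k ih =>
    have h2 : Even (2 ^ (k + 1)) := ⟨2 ^ k, by ring⟩
    rw [sign_iteratedWreathToPermHom_succ, mem_sylG_succ_succ, ← ih, ← ih]
    obtain ⟨m, hm⟩ := h2
    rw [hm, pow_add, Int.units_mul_self, mul_one]
    generalize Equiv.Perm.sign (iteratedWreathToPermHom C2 (k + 1) g.fst) = a
    generalize Equiv.Perm.sign (iteratedWreathToPermHom C2 (k + 1) g.snd) = b
    revert a b
    decide

/-! ### Orders and Sylow subgroups. -/

theorem exists_notMem_sylG (k : ℕ) : ∃ g : WreathPower (k + 1), g ∉ sylG (k + 1) := by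
  induction k with
  | zero =>
    refine ⟨mk 1 1 C2.swap, fun h => ?_⟩
    have h4 : C2.swap = 1 := congrArg (rightHom 0) (show mk 1 1 C2.swap = 1 from h)
    exact absurd h4 (by decide)
  | succ k ih =>
    obtain ⟨g, hg⟩ := ih
    refine ⟨mk g 1 1, ?_⟩
    rw [mem_sylG_succ_succ, fst_mk, snd_mk]
    exact fun h => hg (h.2 (one_mem _))

theorem index_sylG (k : ℕ) : (sylG (k + 1)).index = 2 := by
  obtain ⟨a, ha⟩ := exists_notMem_sylG k
  refine Subgroup.index_eq_two_iff.2 ⟨a, fun b => ?_⟩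
  rw [mul_mem_sylG_iff, xor_iff_iff_not]
  tauto

theorem card_perm_fin_two_pow_factorization (k : ℕ) :
    (Nat.card (Equiv.Perm (Fin (2 ^ k)))).factorization 2 = ∑ i ∈ Finset.range k, 2 ^ i := by
  rw [Nat.card_perm, Nat.card_fin,
    ← Nat.multiplicity_eq_factorization Nat.prime_two (2 ^ k).factorial_ne_zero,
    Nat.Prime.multiplicity_factorial_pow Nat.prime_two]

/-- By Legendre's formula `|B_{k+1}|` is the full 2-part of `(2^(k+1))!`; passing to the index-two
subgroups halves both sides. -/
theorem card_sylG (k : ℕ) : Nat.card (sylG (k + 1)) =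
    2 ^ (Nat.card (alternatingGroup (Fin (2 ^ (k + 1))))).factorization 2 := by
  have : Nontrivial (Fin (2 ^ (k + 1))) :=
    Fin.nontrivial_iff_two_le.2 (Nat.le_self_pow k.succ_ne_zero 2)
  have h₁ := card_perm_fin_two_pow_factorization (k + 1)
  rw [← two_mul_nat_card_alternatingGroup,
    Nat.factorization_mul two_ne_zero Nat.card_pos.ne', Finsupp.add_apply,
    Nat.Prime.factorization_self Nat.prime_two] at h₁
  have h₂ : Nat.card (WreathPower (k + 1)) = _ := IteratedWreathProduct.card C2 (k + 1)
  have h₃ : Nat.card C2 = 2 := by simp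
  rw [h₃, ← h₁, ← (sylG (k + 1)).card_mul_index, index_sylG, pow_add, pow_one, mul_comm] at h₂
  exact Nat.eq_of_mul_eq_mul_left two_pos h₂

theorem nonempty_sylow_alternatingGroup_mulEquiv_sylG {k : ℕ} (hk : 1 ≤ k)
    (P : Sylow 2 (alternatingGroup (Fin (2 ^ k)))) : Nonempty (P ≃* sylG k) := by
  obtain ⟨k, rfl⟩ := Nat.exists_eq_add_of_le' hk
  let e : (Fin (k + 1) → C2) ≃ Fin (2 ^ (k + 1)) := Fintype.equivFinOfCardEq (by simp)
  let f : sylG (k + 1) →* alternatingGroup (Fin (2 ^ (k + 1))) :=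
    ((e.permCongrHom.toMonoidHom.comp (iteratedWreathToPermHom C2 (k + 1))).comp
      (sylG (k + 1)).subtype).codRestrict _ fun g => by
        rw [Equiv.Perm.mem_alternatingGroup]
        exact (Equiv.Perm.sign_permCongr e _).trans
          ((sign_iteratedWreathToPermHom_eq_one_iff k g).2 g.2)
  have hf : Function.Injective f := by
    intro a b hab
    exact Subtype.ext (iteratedWreathToPermHomInj C2 (k + 1)
      (e.permCongrHom.injective (congrArg Subtype.val hab)))
  let g := MonoidHom.ofInjective hf
  -- The embedded copy of `G_{k+1}` has Sylow order, and any two Sylow subgroups are isomorphic.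
  let P' : Sylow 2 (alternatingGroup (Fin (2 ^ (k + 1)))) :=
    Sylow.ofCard f.range (by rw [← Nat.card_congr g.toEquiv, card_sylG])
  exact ⟨(P.equiv P').trans g.symm⟩

theorem mainTheorem1 (k : ℕ) (hk : 1 ≤ k) :
    (∀ P : Sylow 2 (alternatingGroup (Fin (2 ^ k))), Nonempty (P ≃* sylG k)) ∧
    (commutator (sylG k) : Set (sylG k)) = {w | ∃ f₁ f₂ : sylG k, w = f₁ * f₂ * f₁⁻¹ * f₂⁻¹} ∧
    (∀ P : Sylow 2 (alternatingGroup (Fin (2 ^ k))),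
      (2 ≤ k → commutatorWidth P ≤ 1) ∧
      (k = 2 → commutatorWidth P = 0) ∧
      (3 ≤ k → commutatorWidth P = 1)) := by
  refine ⟨nonempty_sylow_alternatingGroup_mulEquiv_sylG hk, coe_commutator_sylG hk, fun P => ?_⟩
  obtain ⟨e⟩ := nonempty_sylow_alternatingGroup_mulEquiv_sylG hk P
  have hle : commutatorWidth (sylG k) ≤ 1 :=
    commutatorWidth_le_one fun _ => exists_commutator_of_mem_commutator_sylG hk
  rw [e.commutatorWidth_eq]
  refine ⟨fun _ => hle, ?_, fun h => hle.antisymm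
    (one_le_commutatorWidth (exists_ne_one_mem_commutator_sylG h))⟩
  rintro rfl
  exact commutatorWidth_eq_zero commutator_sylG_two
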